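/- All groups are finite. Let $G$ be a group with subgroups $A$ and $B$ such that $G=AB$, $A$ is normal in $G$, $A\cap B=1$, and $B$ permutes with every maximal subgroup $M$ of every Sylow subgroup of $A$ (that is, $BM=MB$); in this case $G=[A]B$ is called a weak direct product of $A$ and $B$. A subgroup $H$ of a group $X$ is called $\mathbb{P}$-subnormal in $X$ if either $H=X$ or there is a chain of subgroups $H=H_0\leqslant H_1\leqslant\cdots\leqslant H_n=X$ such that $|H_i:H_{i-1}|$ is a prime for every $i=1,\dots,n$. A group $X$ is called $w$-supersoluble if every Sylow subgroup of $X$ is $\mathbb{P}$-subnormal in $X$. If $A$ and $B$ are $w$-supersoluble, then $G$ is $w$-supersoluble. -/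

import Mathlib

open scoped Pointwise

/-- Two subgroups `H` and `K` permute: `HK = KH` as subsets of the group. -/
def SubgroupsPermute {G : Type*} [Group G] (H K : Subgroup G) : Prop :=
  (H : Set G) * (K : Set G) = (K : Set G) * (H : Set G)

/-- `G = AB` is a weak normal product of `A` and `B`: `A` is normal in `G`, and `B` permutes with
every maximal subgroup `M` of every Sylow subgroup `P` of `A`. All subgroups are regarded as
subgroups of `G`; `M ⋖ P` says that `M < P` with no subgroup strictly in between. -/
structure IsWeakNormalProduct {G : Type*} [Group G] (A B : Subgroup G) : Prop where
  mul_eq_univ : (A : Set G) * (B : Set G) = Set.univ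
  normal : A.Normal
  permutes : ∀ p : ℕ, p.Prime → ∀ P : Sylow p A, ∀ M : Subgroup G,
    M ⋖ (P : Subgroup A).map A.subtype → SubgroupsPermute B M

/-- `G = [A]B` is a weak direct product: a weak normal product with `A ∩ B = 1`. -/
structure IsWeakDirectProduct {G : Type*} [Group G] (A B : Subgroup G) : Prop
    extends IsWeakNormalProduct A B where
  inf_eq_bot : A ⊓ B = ⊥

/-- `H` is `ℙ`-subnormal in `G`: either `H = G`, or there is a chain
`H = H₀ ≤ H₁ ≤ ⋯ ≤ Hₙ = G` in which every index `|Hᵢ₊₁ : Hᵢ|` is a prime. -/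
def IsPSubnormal {G : Type*} [Group G] (H : Subgroup G) : Prop :=
  H = ⊤ ∨ ∃ (n : ℕ) (C : ℕ → Subgroup G), C 0 = H ∧ C n = ⊤ ∧
    ∀ i < n, C i ≤ C (i + 1) ∧ ((C i).relIndex (C (i + 1))).Prime

/-- `G` is `w`-supersoluble: every Sylow subgroup of `G` is `ℙ`-subnormal in `G`. -/
def IsWSupersoluble (G : Type*) [Group G] : Prop :=
  ∀ p : ℕ, p.Prime → ∀ P : Sylow p G, IsPSubnormal (P : Subgroup G)

/-! Fix a prime q, a Sylow q-subgroup C of B and a Sylow q-subgroup Q ≥ C of AC. The chain from C to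
B, multiplied by A, leads from AC to G, and Q is Sylow in G; what remains is a chain from Q to AC
(`primeIndexChain_sup_of_normalizes`). Since A ∩ B = 1, permuting with a maximal subgroup of a Sylow
subgroup of A means normalizing it (`IsWeakDirectProduct.conj_mem`).

Induct on the group order. For the largest prime p dividing |A|, a Sylow p-subgroup P of A is normal
(`IsSylowIn.le_normalizer_of_primeIndexChain`), so G/P gives a chain from QP to AC. If q ≠ p, then Q
= (Q ∩ A)C acts on P as an abelian group of exponent dividing p - 1: Q ∩ A by
`conj_eq_of_primeIndexChain`, and C because it acts by scalars on Hom(P, Z/p), which detects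
automorphisms of q-power order (`IsPGroup.mulAut_eq_one`). The resulting commuting diagonalizable
operators on Hom(P, Z/p) have a common eigenvector; its kernel is a Q-invariant subgroup of index p
in P, and repetition yields the chain from Q to QP. -/

/-- `H` is contained in `K` with prime index. -/
def PrimeIndexStep {G : Type*} [Group G] (H K : Subgroup G) : Prop :=
  H ≤ K ∧ (H.relIndex K).Prime

/-- There is a chain of subgroups from `H` to `K` all of whose indices are primes. -/
def PrimeIndexChain {G : Type*} [Group G] : Subgroup G → Subgroup G → Prop :=
  Relation.ReflTransGen PrimeIndexStep

/-- `S` is a Sylow `p`-subgroup of the subgroup `A`. -/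
structure IsSylowIn {G : Type*} [Group G] (p : ℕ) (S A : Subgroup G) : Prop where
  le : S ≤ A
  isPGroup : IsPGroup p S
  not_dvd : ¬ p ∣ S.relIndex A

/-! ### Chains of subgroups with prime indices -/

section Chains

variable {G G' : Type*} [Group G] [Group G']

theorem isPSubnormal_iff_primeIndexChain {H : Subgroup G} :
    IsPSubnormal H ↔ PrimeIndexChain H ⊤ := by
  constructor
  · rintro (rfl | ⟨n, C, rfl, hn, hC⟩)
    · exact Relation.ReflTransGen.refl
    · rw [← hn]
      clear hn
      induction n with
      | zero => exact Relation.ReflTransGen.refl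
      | succ n ih =>
        exact (ih fun i hi => hC i (by omega)).tail (hC n (by omega))
  · intro h
    right
    induction h using Relation.ReflTransGen.head_induction_on with
    | refl => exact ⟨0, fun _ => ⊤, rfl, rfl, by simp⟩
    | @head a c hac _ ih =>
      obtain ⟨n, C, h0, hn, hC⟩ := ih
      refine ⟨n + 1, fun i => Nat.casesOn i a C, rfl, hn, ?_⟩
      rintro (_ | i) hi
      · change PrimeIndexStep a (C 0)
        rwa [h0]
      · exact hC i (by omega)

theorem PrimeIndexChain.le {H K : Subgroup G} (h : PrimeIndexChain H K) : H ≤ K := by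
  induction h with
  | refl => exact le_rfl
  | tail _ h ih => exact ih.trans h.1

theorem PrimeIndexChain.trans {H K L : Subgroup G} (h : PrimeIndexChain H K)
    (h' : PrimeIndexChain K L) : PrimeIndexChain H L :=
  Relation.ReflTransGen.trans h h'

theorem primeIndexChain_of_relIndex_dvd {H K : Subgroup G} {p : ℕ} (hp : p.Prime) (hHK : H ≤ K)
    (h : H.relIndex K ∣ p) : PrimeIndexChain H K := by
  rcases (Nat.dvd_prime hp).1 h with h | h
  · rw [le_antisymm hHK (Subgroup.relIndex_eq_one.1 h)]
    exact Relation.ReflTransGen.refl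
  · exact Relation.ReflTransGen.single ⟨hHK, h ▸ hp⟩

theorem relIndex_map_map_dvd (f : G →* G') (H K : Subgroup G) :
    (H.map f).relIndex (K.map f) ∣ H.relIndex K := by
  rw [← Subgroup.relIndex_comap]
  exact Subgroup.relIndex_dvd_of_le_left _ (Subgroup.le_comap_map f H)

/-- The index of the images divides the original prime, so each step either collapses or keeps its
index. -/
theorem PrimeIndexChain.map {H K : Subgroup G} (h : PrimeIndexChain H K) (f : G →* G') :
    PrimeIndexChain (H.map f) (K.map f) := by
  induction h with
  | refl => exact Relation.ReflTransGen.refl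
  | tail _ h ih =>
    exact ih.trans (primeIndexChain_of_relIndex_dvd h.2 (Subgroup.map_mono h.1)
      (relIndex_map_map_dvd f _ _))

theorem PrimeIndexChain.comap {H K : Subgroup G'} (h : PrimeIndexChain H K) {f : G →* G'}
    (hf : Function.Surjective f) : PrimeIndexChain (H.comap f) (K.comap f) := by
  induction h with
  | refl => exact Relation.ReflTransGen.refl
  | tail _ h ih =>
    refine ih.tail ⟨Subgroup.comap_mono h.1, ?_⟩
    rw [Subgroup.relIndex_comap, Subgroup.map_comap_eq_self_of_surjective hf]
    exact h.2

theorem PrimeIndexChain.sup_normal {H K : Subgroup G} (h : PrimeIndexChain H K) (N : Subgroup G)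
    [N.Normal] : PrimeIndexChain (H ⊔ N) (K ⊔ N) := by
  have := (h.map (QuotientGroup.mk' N)).comap (QuotientGroup.mk'_surjective N)
  simpa only [Subgroup.comap_map_eq, QuotientGroup.ker_mk'] using this

theorem relIndex_ne_zero_of_finite [Finite G] (H K : Subgroup G) : H.relIndex K ≠ 0 :=
  Subgroup.index_ne_zero_of_finite

theorem relIndex_sup_of_normal [Finite G] (X L : Subgroup G) [L.Normal] :
    X.relIndex (X ⊔ L) = X.relIndex L := by
  have h1 := Subgroup.relIndex_mul_relIndex (X ⊓ L) X (X ⊔ L) inf_le_left le_sup_left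
  have h2 := Subgroup.relIndex_mul_relIndex (X ⊓ L) L (X ⊔ L) inf_le_right le_sup_right
  rw [Subgroup.inf_relIndex_left] at h1
  rw [Subgroup.inf_relIndex_right, Subgroup.relIndex_sup_right, mul_comm, ← h1] at h2
  exact (Nat.eq_of_mul_eq_mul_left (Nat.pos_of_ne_zero (relIndex_ne_zero_of_finite _ _)) h2).symm

theorem relIndex_sup_of_le_normalizer [Finite G] {X L : Subgroup G}
    (h : X ≤ Subgroup.normalizer (L : Set G)) : X.relIndex (X ⊔ L) = X.relIndex L := by
  set Y := Subgroup.normalizer (L : Set G)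
  have hL : L ≤ Y := Subgroup.le_normalizer
  have : (L.subgroupOf Y).Normal := Subgroup.normal_in_normalizer
  have := relIndex_sup_of_normal (X.subgroupOf Y) (L.subgroupOf Y)
  rwa [← Subgroup.subgroupOf_sup h hL, Subgroup.relIndex_subgroupOf (sup_le h hL),
    Subgroup.relIndex_subgroupOf hL] at this

theorem primeIndexChain_sup_of_relIndex_eq [Finite G] {Q N L : Subgroup G} {p : ℕ} (hp : p.Prime)
    (hQ : Q ≤ Subgroup.normalizer (L : Set G)) (hNL : N ≤ L) (h : N.relIndex L = p) :
    PrimeIndexChain (Q ⊔ N) (Q ⊔ L) := by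
  refine primeIndexChain_of_relIndex_dvd hp (sup_le_sup_left hNL Q) ?_
  have h1 : Q ⊔ L = (Q ⊔ N) ⊔ L := by rw [sup_assoc, sup_eq_right.2 hNL]
  rw [h1, relIndex_sup_of_le_normalizer (sup_le hQ (hNL.trans Subgroup.le_normalizer)), ← h]
  exact Subgroup.relIndex_dvd_of_le_left _ le_sup_right

theorem le_normalizer_inf_of_le {H K : Subgroup G} (hHK : H ≤ K) (P : Subgroup G) [P.Normal] :
    H ≤ Subgroup.normalizer ((K ⊓ P : Subgroup G) : Set G) := by
  refine fun h hh => Subgroup.mem_normalizer_iff.2 fun x => ?_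
  rw [Subgroup.mem_inf, Subgroup.mem_inf, Subgroup.Normal.mem_comm_iff (H := P) inferInstance]
  simp [Subgroup.mul_mem_cancel_right, Subgroup.mul_mem_cancel_left, hHK hh]

/-- H normalizes K ∩ P, so |K ∩ P : H ∩ P| = |H(K ∩ P) : H|, a factor of |K : H|. -/
theorem relIndex_inf_normal_dvd [Finite G] {H K : Subgroup G} (hHK : H ≤ K) (P : Subgroup G)
    [P.Normal] : (H ⊓ P).relIndex (K ⊓ P) ∣ H.relIndex K := by
  have h1 : H ⊓ P = H ⊓ (K ⊓ P) := by rw [← inf_assoc, inf_eq_left.2 hHK]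
  have h2 := le_normalizer_inf_of_le hHK P
  rw [h1, Subgroup.inf_relIndex_right, ← relIndex_sup_of_le_normalizer h2]
  rw [← Subgroup.relIndex_mul_relIndex H (H ⊔ (K ⊓ P)) K le_sup_left (sup_le hHK inf_le_left)]
  exact dvd_mul_right _ _

end Chains

/-! ### Sylow subgroups of subgroups -/

section SylowIn

variable {G G' : Type*} [Group G] [Group G'] {p : ℕ}

theorem IsPGroup.relIndex_eq_one_of_not_dvd [Finite G] [Fact p.Prime] {S T : Subgroup G}
    (hT : IsPGroup p T) (h : ¬ p ∣ S.relIndex T) : S.relIndex T = 1 := by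
  obtain ⟨n, hn⟩ := (Nat.dvd_prime_pow Fact.out).1
    ((hT.exists_card_eq.choose_spec) ▸ Subgroup.relIndex_dvd_card S T)
  rcases Nat.eq_zero_or_pos n with rfl | h0
  · simpa using hn.2
  · exact absurd (hn.2 ▸ dvd_pow_self p h0.ne') h

theorem IsSylowIn.le_of_isPGroup [Finite G] [Fact p.Prime] {S A T : Subgroup G}
    (hS : IsSylowIn p S A) (hT : IsPGroup p T) (hTA : T ≤ A)
    (hn : T ≤ Subgroup.normalizer (S : Set G)) : T ≤ S := by
  have h1 : IsPGroup p (T ⊔ S : Subgroup G) := hT.to_sup_of_normal_right' hS.isPGroup hn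
  have h2 : ¬ p ∣ S.relIndex (T ⊔ S) := fun h => hS.not_dvd <| by
    rw [← Subgroup.relIndex_mul_relIndex S (T ⊔ S) A le_sup_right (sup_le hTA hS.le)]
    exact h.mul_right _
  exact le_sup_left.trans (Subgroup.relIndex_eq_one.1 (h1.relIndex_eq_one_of_not_dvd h2))

theorem IsPGroup.exists_isSylowIn [Finite G] [Fact p.Prime] {T A : Subgroup G}
    (hT : IsPGroup p T) (hTA : T ≤ A) : ∃ S, IsSylowIn p S A ∧ T ≤ S := by
  obtain ⟨S, hS⟩ := IsPGroup.exists_le_sylow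
    (hT.of_equiv (Subgroup.subgroupOfEquivOfLe hTA).symm)
  refine ⟨(S : Subgroup A).map A.subtype, ⟨Subgroup.map_subtype_le _, S.2.map _, ?_⟩, ?_⟩
  · have := S.not_dvd_index
    rwa [Subgroup.relIndex, Subgroup.subgroupOf, Subgroup.comap_map_eq_self_of_injective
      A.subtype_injective]
  · intro t ht
    exact ⟨⟨t, hTA ht⟩, hS ht, rfl⟩

theorem IsSylowIn.trans [Fact p.Prime] {S A K : Subgroup G} (h : IsSylowIn p S A) (hAK : A ≤ K)
    (hi : ¬ p ∣ A.relIndex K) : IsSylowIn p S K :=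
  ⟨h.le.trans hAK, h.isPGroup, by
    rw [← Subgroup.relIndex_mul_relIndex S A K h.le hAK]
    exact Nat.Prime.not_dvd_mul Fact.out h.not_dvd hi⟩

theorem IsSylowIn.map {S A : Subgroup G} (h : IsSylowIn p S A) (f : G →* G') :
    IsSylowIn p (S.map f) (A.map f) :=
  ⟨Subgroup.map_mono h.le, h.isPGroup.map f, fun hd =>
    h.not_dvd (hd.trans (relIndex_map_map_dvd f S A))⟩

theorem IsSylowIn.eq_of_le [Finite G] [Fact p.Prime] {S T A : Subgroup G}
    (hS : IsSylowIn p S A) (hT : IsPGroup p T) (hTA : T ≤ A) (hST : S ≤ T) : S = T := by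
  refine le_antisymm hST (Subgroup.relIndex_eq_one.1 (hT.relIndex_eq_one_of_not_dvd fun h => ?_))
  refine hS.not_dvd ?_
  rw [← Subgroup.relIndex_mul_relIndex S T A hST hTA]
  exact h.mul_right _

/-- A Sylow subgroup of f⁻¹(S') ∩ A is Sylow in A; its image is Sylow in f(A) and lies in S', hence
equals S'. -/
theorem IsSylowIn.exists_map_eq [Finite G] [Finite G'] [Fact p.Prime] {f : G →* G'}
    {A : Subgroup G} {S' : Subgroup G'} (h : IsSylowIn p S' (A.map f)) :
    ∃ S, IsSylowIn p S A ∧ S.map f = S' := by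
  obtain ⟨S, hS, -⟩ := (IsPGroup.of_bot (p := p) (G := G)).exists_isSylowIn
    (bot_le : ⊥ ≤ S'.comap f ⊓ A)
  have hi : ¬ p ∣ (S'.comap f ⊓ A).relIndex A := by
    rw [Subgroup.inf_relIndex_right, Subgroup.relIndex_comap]
    exact h.not_dvd
  have hSA := hS.trans inf_le_right hi
  refine ⟨S, hSA, (hSA.map f).eq_of_le h.isPGroup h.le ?_⟩
  exact Subgroup.map_le_iff_le_comap.2 (hS.le.trans inf_le_left)

theorem IsSylowIn.inf_normal [Finite G] {S K A : Subgroup G}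
    (h : IsSylowIn p S K) (hAK : A ≤ K) [A.Normal] : IsSylowIn p (S ⊓ A) A := by
  refine ⟨inf_le_right, h.isPGroup.to_inf_left, fun hd => h.not_dvd (hd.trans ?_)⟩
  have := relIndex_inf_normal_dvd h.le A
  rwa [inf_eq_right.2 hAK] at this

/-- Climb the chain. A step H < K has prime index below p: at most p by maximality, and not p since
S is Sylow. For a conjugate T of S in K, |T : T ∩ H| is a power of p that is less than p, so T ≤ H;
by induction T normalizes S, so T ≤ S. -/
theorem IsSylowIn.le_normalizer_of_primeIndexChain [Finite G] [Fact p.Prime] {S K : Subgroup G}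
    (hS : IsSylowIn p S K) (hmax : ∀ r, r.Prime → r ∣ Nat.card K → r ≤ p)
    (hc : PrimeIndexChain S K) : K ≤ Subgroup.normalizer (S : Set G) := by
  induction hc with
  | refl => exact Subgroup.le_normalizer
  | @tail H K hSH hHK ih =>
    have hSH := PrimeIndexChain.le hSH
    have hS' : IsSylowIn p S H := ⟨hSH, hS.isPGroup, fun h => hS.not_dvd <| by
      rw [← Subgroup.relIndex_mul_relIndex S H K hSH hHK.1]
      exact h.mul_right _⟩
    have ih := ih hS' fun r hr hd => hmax r hr (hd.trans (Subgroup.card_dvd_of_le hHK.1))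
    have hlt : H.relIndex K < p := by
      refine lt_of_le_of_ne (hmax _ hHK.2 (Subgroup.relIndex_dvd_card H K)) fun h => hS.not_dvd ?_
      rw [← Subgroup.relIndex_mul_relIndex S H K hSH hHK.1, h]
      exact dvd_mul_left _ _
    have key : ∀ k ∈ K, ∀ x ∈ S, k * x * k⁻¹ ∈ S := by
      intro k hk
      set T := S.map (MulAut.conj k).toMonoidHom with hT
      have hTp : IsPGroup p T := hS.isPGroup.map _
      have hTK : T ≤ K := by
        rintro _ ⟨x, hx, rfl⟩
        exact K.mul_mem (K.mul_mem hk (hS.le hx)) (K.inv_mem hk)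
      have hTH : T ≤ H := by
        refine Subgroup.relIndex_eq_one.1 (hTp.relIndex_eq_one_of_not_dvd fun hd => ?_)
        have h1 := Nat.le_of_dvd (Nat.pos_of_ne_zero (relIndex_ne_zero_of_finite _ _)) hd
        have h2 := Subgroup.relIndex_le_of_le_right (H := H) hTK (relIndex_ne_zero_of_finite _ _)
        omega
      have hTS := hS'.le_of_isPGroup hTp hTH (hTH.trans ih)
      exact fun x hx => hTS ⟨x, hx, rfl⟩
    refine fun k hk => Subgroup.mem_normalizer_iff.2 fun x => ⟨key k hk x, fun hx => ?_⟩
    have := key k⁻¹ (K.inv_mem hk) _ hx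
    simpa [mul_assoc] using this

end SylowIn

/-! ### Homomorphisms to Z/p and coprime automorphisms -/

/-- `f` is a homomorphism from the multiplicative group `P` to the additive group of `ZMod p`. -/
def IsZModHom {P : Type*} [Group P] {p : ℕ} (f : P → ZMod p) : Prop :=
  ∀ x y, f (x * y) = f x + f y

namespace IsZModHom

variable {P : Type*} [Group P] {p : ℕ} {f : P → ZMod p}

/-- A function satisfying `IsZModHom` as a bundled homomorphism. -/
def toMonoidHom (hf : IsZModHom f) : P →* Multiplicative (ZMod p) :=
  MonoidHom.mk' (fun x => Multiplicative.ofAdd (f x)) fun x y => by rw [hf x y]; rfl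

theorem map_one (hf : IsZModHom f) : f 1 = 0 := hf.toMonoidHom.map_one

theorem map_inv (hf : IsZModHom f) (x : P) : f x⁻¹ = -f x := hf.toMonoidHom.map_inv x

theorem map_pow (hf : IsZModHom f) (x : P) (n : ℕ) : f (x ^ n) = n * f x := by
  have := hf.toMonoidHom.map_pow x n
  rw [← nsmul_eq_mul]
  exact this

theorem comp (hf : IsZModHom f) (α : MulAut P) : IsZModHom fun x => f (α x) := fun x y => by
  simp only [_root_.map_mul, hf (α x)]

theorem index_ker [Fact p.Prime] (hf : IsZModHom f) (h0 : ∃ x, f x ≠ 0) :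
    hf.toMonoidHom.ker.index = p := by
  obtain ⟨x, hx⟩ := h0
  have hcard : Nat.card (Multiplicative (ZMod p)) = p := Nat.card_zmod p
  have : Fact (Nat.card (Multiplicative (ZMod p))).Prime := ⟨hcard.symm ▸ Fact.out⟩
  rw [Subgroup.index_ker]
  rcases hf.toMonoidHom.range.eq_bot_or_eq_top_of_prime_card with h | h
  · exact absurd ((Subgroup.mem_bot).1 (h ▸ ⟨x, rfl⟩ : hf.toMonoidHom x ∈ ⊥)) hx
  · rw [h, Subgroup.card_top, hcard]

/-- An automorphism that preserves the kernel of `f` multiplies `f` by a scalar. -/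
theorem exists_scalar [Fact p.Prime] (hf : IsZModHom f) {α : MulAut P}
    (hα : ∀ x, f x = 0 → f (α x) = 0) : ∃ c : ZMod p, ∀ x, f (α x) = c * f x := by
  by_cases h0 : ∃ x, f x ≠ 0
  · obtain ⟨x₀, hx₀⟩ := h0
    refine ⟨f (α x₀) / f x₀, fun x => ?_⟩
    -- Correcting x by a power of x₀ moves it into the kernel.
    have h1 : f (x * (x₀ ^ (f x / f x₀).val)⁻¹) = 0 := by
      rw [hf, hf.map_inv, hf.map_pow, ZMod.natCast_zmod_val]
      field_simp
      ring
    have h2 := hα _ h1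
    rw [_root_.map_mul, _root_.map_inv, _root_.map_pow, hf, hf.map_inv, hf.map_pow,
      ZMod.natCast_zmod_val, add_neg_eq_zero] at h2
    rw [h2]
    field_simp
  · push Not at h0
    exact ⟨0, fun x => by simp [h0]⟩

/-- An automorphism of `q`-power order preserving `f` fixes a point in every fibre of `f`. -/
theorem exists_fixed_point [Finite P] [Fact p.Prime] (hP : IsPGroup p P) (hf : IsZModHom f)
    {q n : ℕ} [Fact q.Prime] (hqp : q ≠ p) {α : MulAut P} (hα : α ^ q ^ n = 1)
    (h : ∀ x, f (α x) = f x) (x : P) : ∃ y, f y = f x ∧ α y = y := by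
  have := Fintype.ofFinite P
  let σ : Equiv.Perm {y // f y = f x} := Equiv.Perm.subtypePerm α.toEquiv fun y => by
    rw [MulEquiv.toEquiv_eq_coe, MulEquiv.coe_toEquiv, h]
  have hiter : ∀ (m : ℕ) (y : {y // f y = f x}), ((σ ^ m) y : P) = (α ^ m) y := by
    intro m
    induction m with
    | zero => simp
    | succ m ih =>
      intro y
      rw [pow_succ, pow_succ, Equiv.Perm.mul_apply, ih, MulAut.mul_apply]
      rfl
  have hσ : σ ^ q ^ n = 1 := by
    ext y
    rw [hiter, hα]
    rfl
  -- The fibre is in bijection with the kernel, a p-group, so a permutation of q-power order fixes a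
  -- point of it.
  have hcard : ¬ q ∣ Nat.card {y // f y = f x} := by
    have e : {y // f y = f x} ≃ hf.toMonoidHom.ker := hf.toMonoidHom.fiberEquivKer x
    rw [Nat.card_congr e]
    obtain ⟨k, hk⟩ := (hP.to_subgroup hf.toMonoidHom.ker).exists_card_eq
    rw [hk]
    intro hd
    exact hqp ((Nat.prime_dvd_prime_iff_eq Fact.out Fact.out).1
      ((Fact.out : q.Prime).dvd_of_dvd_pow hd))
  classical
  rw [Nat.card_eq_fintype_card] at hcard
  obtain ⟨⟨y, hy⟩, hfix⟩ := Equiv.Perm.exists_fixed_point_of_prime hcard hσ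
  exact ⟨y, hy, congrArg Subtype.val hfix⟩

end IsZModHom

section PGroups

variable {P : Type*} [Group P] [Finite P] {p : ℕ} [Fact p.Prime]

theorem IsPGroup.exists_le_index_eq (hP : IsPGroup p P) {H : Subgroup P} (hH : H ≠ ⊤) :
    ∃ M, H ≤ M ∧ M.index = p := by
  obtain ⟨n, hn⟩ := hP.exists_card_eq
  obtain ⟨m, hm⟩ := (hP.to_subgroup H).exists_card_eq
  have hp : p.Prime := Fact.out
  have hmn : m < n := by
    have h1 : Nat.card H < Nat.card P :=
      lt_of_le_of_ne (Subgroup.card_le_card_group H) fun h => hH (Subgroup.eq_top_of_card_eq H h)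
    rw [hn, hm] at h1
    exact (Nat.pow_lt_pow_iff_right hp.one_lt).1 h1
  obtain ⟨M, hM, hHM⟩ := Sylow.exists_subgroup_card_pow_prime_le p (m := n - 1)
    (hn ▸ pow_dvd_pow p (Nat.sub_le n 1)) H hm (by omega)
  refine ⟨M, hHM, ?_⟩
  have h1 := M.card_mul_index
  have h2 : p ^ n = p ^ (n - 1) * p := by rw [← pow_succ]; congr 1; omega
  rw [hM, hn, h2] at h1
  exact Nat.eq_of_mul_eq_mul_left (pow_pos hp.pos _) h1

theorem IsPGroup.exists_isZModHom (hP : IsPGroup p P) {N : Subgroup P} (hN : N.index = p) :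
    ∃ f : P → ZMod p, IsZModHom f ∧ ∀ x, f x = 0 ↔ x ∈ N := by
  obtain ⟨n, hn⟩ := hP.exists_card_eq
  have hp : p.Prime := Fact.out
  have hn0 : n ≠ 0 := by
    rintro rfl
    have := N.index_dvd_card
    rw [hn, hN, pow_zero, Nat.dvd_one] at this
    exact hp.one_lt.ne' this
  have : N.Normal := Subgroup.normal_of_index_eq_minFac_card (by rw [hn, hN, hp.pow_minFac hn0])
  let e : P ⧸ N ≃* Multiplicative (ZMod p) := mulEquivOfPrimeCardEq (p := p) hN (Nat.card_zmod p)
  refine ⟨fun x => (e (x : P ⧸ N)).toAdd, fun x y => by simp, fun x => ?_⟩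
  rw [← QuotientGroup.eq_one_iff, ← e.map_eq_one_iff]
  rfl

/-- An automorphism of order prime to `p` acting trivially on `Hom(P, ZMod p)` is trivial. -/
theorem IsPGroup.mulAut_eq_one (hP : IsPGroup p P) {q n : ℕ} [Fact q.Prime] (hqp : q ≠ p)
    {α : MulAut P} (hα : α ^ q ^ n = 1)
    (h : ∀ f : P → ZMod p, IsZModHom f → ∀ x, f (α x) = f x) : α = 1 := by
  by_contra hne
  let C : Subgroup P := MonoidHom.eqLocus α.toMonoidHom (MonoidHom.id P)
  have hC : C ≠ ⊤ := fun hC => hne <| by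
    ext x
    exact (hC ▸ Subgroup.mem_top x : x ∈ C)
  obtain ⟨M, hCM, hM⟩ := hP.exists_le_index_eq hC
  obtain ⟨f, hf, hker⟩ := hP.exists_isZModHom hM
  have hM' : M ≠ ⊤ := by
    rintro rfl
    rw [Subgroup.index_top] at hM
    exact (Fact.out : p.Prime).one_lt.ne hM
  obtain ⟨x, hx⟩ : ∃ x, x ∉ M := by
    by_contra hall
    push Not at hall
    exact hM' ((Subgroup.eq_top_iff' M).2 hall)
  -- A fibre of f outside M contains a fixed point, although all fixed points lie in M.
  obtain ⟨y, hy, hfix⟩ := hf.exists_fixed_point hP hqp hα (h f hf) x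
  have hyM : y ∈ M := hCM hfix
  exact hx ((hker x).1 (hy ▸ (hker y).2 hyM))

end PGroups

/-! ### Common eigenvectors -/

section Eigenvectors

variable {p : ℕ} [Fact p.Prime] {V : Type*} [AddCommGroup V] [Module (ZMod p) V] [Finite V]

/-- Each operator is killed by X^p - X, which splits, so it has an eigenvalue on a minimal nonzero
invariant subspace. The eigenspace is invariant under the commuting operators, so by minimality it
is everything. -/
theorem exists_common_eigenvector {ι : Type*} (T : ι → Module.End (ZMod p) V)
    (hcomm : ∀ i j, Commute (T i) (T j)) (hpow : ∀ i, T i ^ (p - 1) = 1)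
    {U : Submodule (ZMod p) V} (hU : U ≠ ⊥) (hTU : ∀ i, ∀ v ∈ U, T i v ∈ U) :
    ∃ v ∈ U, v ≠ 0 ∧ ∀ i, ∃ c : ZMod p, T i v = c • v := by
  let S : Set (Submodule (ZMod p) V) := {W | W ≤ U ∧ W ≠ ⊥ ∧ ∀ i, ∀ v ∈ W, T i v ∈ W}
  obtain ⟨W, hW⟩ := (Set.toFinite S).exists_minimal ⟨U, le_rfl, hU, hTU⟩
  obtain ⟨hWU, hW0, hTW⟩ := hW.prop
  obtain ⟨v, hvW, hv0⟩ := (Submodule.ne_bot_iff W).1 hW0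
  refine ⟨v, hWU hvW, hv0, fun i => ?_⟩
  let R : Module.End (ZMod p) W := (T i).restrict (hTW i)
  have hR : R ^ (p - 1) = 1 := by
    rw [Module.End.pow_restrict]
    ext w
    simp [hpow]
  have : Nontrivial W := Submodule.nontrivial_iff_ne_bot.2 hW0
  obtain ⟨c, hc⟩ : ∃ c, R.HasEigenvalue c := by
    have hp : p.Prime := Fact.out
    have hdvd : minpoly (ZMod p) R ∣ Polynomial.X ^ p - Polynomial.X := by
      apply minpoly.dvd
      have h2 : R ^ p = R := by
        rw [← pow_sub_one_mul hp.ne_zero R, hR, one_mul]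
      simp [h2]
    have hsplit : (Polynomial.X ^ p - Polynomial.X : Polynomial (ZMod p)).Splits :=
      by simpa using FiniteField.splits_X_pow_card_sub_X (K := ZMod p) p
    have hne : (Polynomial.X ^ p - Polynomial.X : Polynomial (ZMod p)) ≠ 0 :=
      FiniteField.X_pow_card_sub_X_ne_zero _ hp.one_lt
    have hs := hsplit.of_dvd hne hdvd
    obtain ⟨c, hc⟩ := hs.exists_eval_eq_zero (by
      exact (minpoly.degree_pos (Algebra.IsIntegral.isIntegral R)).ne')
    exact ⟨c, Module.End.hasEigenvalue_of_isRoot hc⟩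
  obtain ⟨w, hw⟩ := hc.exists_hasEigenvector
  have hw1 : T i w = c • (w : V) := congrArg Subtype.val hw.apply_eq_smul
  let W' : Submodule (ZMod p) V := W ⊓ (T i).eigenspace c
  have hW' : W' ∈ S := by
    refine ⟨inf_le_left.trans hWU, (Submodule.ne_bot_iff _).2 ⟨w, ⟨w.2, ?_⟩, ?_⟩, ?_⟩
    · exact Module.End.mem_eigenspace_iff.2 hw1
    · exact fun h => hw.2 (Subtype.ext h)
    · rintro j u ⟨huW, hu⟩
      refine ⟨hTW j u huW, Module.End.mem_eigenspace_iff.2 ?_⟩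
      have h3 : T i (T j u) = T j (T i u) := LinearMap.congr_fun (hcomm i j).eq u
      rw [h3, Module.End.mem_eigenspace_iff.1 hu, map_smul]
  exact ⟨c, Module.End.mem_eigenspace_iff.1 (hW.le_of_le hW' inf_le_left hvW).2⟩

end Eigenvectors

section Action

variable {P : Type*} [Group P] {p : ℕ} [Fact p.Prime]

/-- The automorphisms act by composition on Hom(P, Z/p), a nonzero subspace of all functions; a
common eigenvector has invariant kernel. -/
theorem IsPGroup.exists_invariant_isZModHom [Finite P] (hP : IsPGroup p P) [Nontrivial P] {ι : Type*}
    (α : ι → MulAut P) (hcomm : ∀ i j, Commute (α i) (α j)) (hpow : ∀ i, α i ^ (p - 1) = 1) :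
    ∃ f : P → ZMod p, IsZModHom f ∧ (∃ x, f x ≠ 0) ∧ ∀ i x, f x = 0 → f (α i x) = 0 := by
  let U : Submodule (ZMod p) (P → ZMod p) :=
    { carrier := {f | IsZModHom f}
      add_mem' := fun {f g} hf hg x y => by simp only [Pi.add_apply, hf x y, hg x y]; ring
      zero_mem' := fun x y => by simp
      smul_mem' := fun c f hf x y => by simp only [Pi.smul_apply, hf x y, smul_add] }
  let T : ι → Module.End (ZMod p) (P → ZMod p) := fun i => LinearMap.funLeft _ _ (α i)
  have hTpow : ∀ i n f x, (T i ^ n) f x = f ((α i ^ n) x) := by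
    intro i n
    induction n with
    | zero => intro f x; rfl
    | succ n ih =>
      intro f x
      rw [pow_succ, Module.End.mul_apply, ih, pow_succ', MulAut.mul_apply]
      rfl
  have hU : U ≠ ⊥ := by
    obtain ⟨M, -, hM⟩ := hP.exists_le_index_eq (bot_ne_top : (⊥ : Subgroup P) ≠ ⊤)
    obtain ⟨f, hf, hker⟩ := hP.exists_isZModHom hM
    refine (Submodule.ne_bot_iff _).2 ⟨f, hf, ?_⟩
    rintro rfl
    rw [(Subgroup.eq_top_iff' M).2 fun x => (hker x).1 rfl, Subgroup.index_top] at hM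
    exact (Fact.out : p.Prime).one_lt.ne hM
  obtain ⟨f, hf, hf0, hev⟩ := exists_common_eigenvector T
    (fun i j => by
      ext1 f
      funext x
      change f (α j (α i x)) = f (α i (α j x))
      rw [← MulAut.mul_apply, (hcomm j i).eq, MulAut.mul_apply])
    (fun i => by ext1 f; funext x; rw [hTpow, hpow]; rfl) hU
    (fun i f hf => IsZModHom.comp hf (α i))
  refine ⟨f, hf, Function.ne_iff.1 hf0, fun i x hx => ?_⟩
  obtain ⟨c, hc⟩ := hev i
  have : f (α i x) = c * f x := congrFun hc x
  rw [this, hx, mul_zero]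

/-- If an automorphism `β` multiplies every homomorphism to `ZMod p` by a scalar, then this
scalar does not depend on the homomorphism. -/
theorem exists_scalar_forall {β : MulAut P}
    (h : ∀ f : P → ZMod p, IsZModHom f → ∃ c : ZMod p, ∀ x, f (β x) = c * f x) :
    ∃ c : ZMod p, ∀ f : P → ZMod p, IsZModHom f → ∀ x, f (β x) = c * f x := by
  by_cases h0 : ∃ f : P → ZMod p, IsZModHom f ∧ ∃ x, f x ≠ 0
  · obtain ⟨f, hf, x₀, hx₀⟩ := h0
    obtain ⟨c, hc⟩ := h f hf
    refine ⟨c, fun g hg x => ?_⟩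
    obtain ⟨d, hd⟩ := h g hg
    -- Compare the scalars c, d, e of f, g and f + g.
    obtain ⟨e, he⟩ := h (fun x => f x + g x) fun x y => by simp only [hf x y, hg x y]; ring
    simp only [hc, hd] at he
    have hy : ∀ y, (c - e) * f y = (e - d) * g y := fun y => by linear_combination he y
    rw [hd]
    by_cases hce : c = e
    · linear_combination hy x - f x * hce - g x * hce
    · have h1 := hy x₀
      have h2 := hy (β x₀)
      rw [hc, hd] at h2
      have h3 : (c - e) * f x₀ * (c - d) = 0 := by linear_combination h2 - d * h1
      rcases mul_eq_zero.1 h3 with h3 | h3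
      · exact absurd h3 (mul_ne_zero (sub_ne_zero.2 hce) hx₀)
      · rw [sub_eq_zero.1 h3]
  · push Not at h0
    exact ⟨0, fun f hf x => by simp [h0 f hf]⟩

end Action

/-! ### Actions of q-groups on p-groups -/

section ConjugationAction

variable {G : Type*} [Group G]

/-- The action by conjugation of a subgroup `Q` normalizing `L` on `L`. -/
def conjHom {Q L : Subgroup G} (h : Q ≤ Subgroup.normalizer (L : Set G)) : Q →* MulAut L :=
  L.normalizerMonoidHom.comp (Subgroup.inclusion h)

theorem exists_character {D P : Type*} [Group D] [Group P] {p : ℕ} [Fact p.Prime]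
    (φ : D →* MulAut P) {f : P → ZMod p} (hf : IsZModHom f) (h0 : ∃ x, f x ≠ 0)
    (h : ∀ d x, f x = 0 → f (φ d x) = 0) :
    ∃ c : D →* ZMod p, ∀ d x, f (φ d x) = c d * f x := by
  choose c hc using fun d => hf.exists_scalar (h d)
  obtain ⟨x₀, hx₀⟩ := h0
  refine ⟨⟨⟨c, ?_⟩, fun d e => ?_⟩, hc⟩
  · refine mul_right_cancel₀ hx₀ ?_
    rw [← hc, map_one, one_mul]
    rfl
  · refine mul_right_cancel₀ hx₀ ?_
    rw [← hc, map_mul, MulAut.mul_apply, hc, hc, mul_assoc]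

/-- Together with `character_pow`: if elements killed by all characters act trivially, the action is
abelian of exponent dividing p - 1. -/
theorem character_commutator {D : Type*} [Group D] {R : Type*} [CommMonoid R] (c : D →* R)
    (d e : D) : c (d * e * (e * d)⁻¹) = 1 := by
  have h : c (d * e) = c (e * d) := by rw [map_mul, map_mul, mul_comm]
  rw [map_mul, h, ← map_mul, mul_inv_cancel, map_one]

theorem character_pow {D : Type*} [Group D] {p : ℕ} [Fact p.Prime] (c : D →* ZMod p) (d : D) :
    c (d ^ (p - 1)) = 1 := by
  rw [map_pow]
  exact ZMod.pow_card_sub_one_eq_one (c.toHomUnits d).ne_zero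

variable [Finite G] {p q : ℕ} [Fact p.Prime] [Fact q.Prime]

/-- If a `q`-group `D` is joined to `K` by a chain with prime indices, then an element of `D` that
lies in the kernel of all characters `D → ZMod p` centralizes `K ⊓ P`, where `P` is a normal
`p`-subgroup. -/
theorem conj_eq_of_primeIndexChain {D K P : Subgroup G} [P.Normal] (hP : IsPGroup p P)
    (hD : IsPGroup q D) (hqp : q ≠ p) (hc : PrimeIndexChain D K) {k : D}
    (hk : ∀ c : D →* ZMod p, c k = 1) : ∀ x ∈ K ⊓ P, (k : G) * x * (k : G)⁻¹ = x := by
  induction hc with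
  | refl =>
    intro x hx
    have := (IsPGroup.disjoint_of_ne q p hqp D P hD hP).le_bot hx
    rw [Subgroup.mem_bot.1 this]
    group
  | @tail H K hDH hHK ih =>
    have hDH := PrimeIndexChain.le hDH
    have hDK := hDH.trans hHK.1
    have hle : H ⊓ P ≤ K ⊓ P := inf_le_inf_right P hHK.1
    rcases (Nat.dvd_prime hHK.2).1 (relIndex_inf_normal_dvd hHK.1 P) with h1 | h1
    · exact fun x hx => ih x (Subgroup.relIndex_eq_one.1 h1 hx)
    · have hL : IsPGroup p (K ⊓ P : Subgroup G) := hP.to_inf_right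
      have hidx : (H ⊓ P).relIndex (K ⊓ P) = p := by
        by_contra hne
        have h2 := hL.relIndex_eq_one_of_not_dvd (S := H ⊓ P) fun hd => hne <| by
          rw [h1] at hd ⊢
          exact ((Nat.prime_dvd_prime_iff_eq Fact.out hHK.2).1 hd).symm
        rw [h2] at h1
        exact hHK.2.one_lt.ne h1
      obtain ⟨f, hf, hker⟩ := hL.exists_isZModHom hidx
      have hn := le_normalizer_inf_of_le hDK P
      have hf0 : ∃ x, f x ≠ 0 := by
        by_contra hall
        push Not at hall
        have : (H ⊓ P).subgroupOf (K ⊓ P) = ⊤ :=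
          (Subgroup.eq_top_iff' _).2 fun x => (hker x).1 (hall x)
        rw [Subgroup.relIndex, this, Subgroup.index_top] at hidx
        exact (Fact.out : p.Prime).one_lt.ne hidx
      obtain ⟨c, hcf⟩ := exists_character (conjHom hn) hf hf0 fun d x hx => by
        rw [hker, Subgroup.mem_subgroupOf] at hx ⊢
        exact ⟨H.mul_mem (H.mul_mem (hDH d.2) hx.1) (H.inv_mem (hDH d.2)),
          Subgroup.Normal.conj_mem inferInstance _ hx.2 _⟩
      obtain ⟨n, hkn⟩ := hD k
      intro x hx
      obtain ⟨y, hy, hfix⟩ := hf.exists_fixed_point hL hqp (α := conjHom hn k) (n := n)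
        (by rw [← map_pow, hkn, map_one]) (fun x => by rw [hcf, hk, one_mul]) ⟨x, hx⟩
      -- The coset of x modulo H ∩ P contains a point y fixed by k; the quotient x y⁻¹ is fixed by
      -- induction.
      have hxy : (⟨x, hx⟩ : (K ⊓ P : Subgroup G)) * y⁻¹ ∈ (H ⊓ P).subgroupOf (K ⊓ P) := by
        rw [← hker, hf, hf.map_inv, hy, add_neg_cancel]
      have h3 : (k : G) * (x * (y : G)⁻¹) * (k : G)⁻¹ = x * (y : G)⁻¹ := ih _ hxy
      have h4 : (k : G) * y * (k : G)⁻¹ = y := congrArg Subtype.val hfix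
      calc (k : G) * x * (k : G)⁻¹
          = ((k : G) * (x * (y : G)⁻¹) * (k : G)⁻¹) * ((k : G) * y * (k : G)⁻¹) := by group
        _ = x := by rw [h3, h4]; group

/-- If `Q` normalizes the `p`-group `P` and acts on it as an abelian group of exponent dividing
`p - 1`, then there is a chain with prime indices from `Q` to `QP`. -/
theorem primeIndexChain_sup_of_abelian_action {Q P : Subgroup G} (hP : IsPGroup p P)
    (hQ : Q ≤ Subgroup.normalizer (P : Set G))
    (hcomm : ∀ g ∈ Q, ∀ h ∈ Q, ∀ x ∈ P, g * h * x * (g * h)⁻¹ = h * g * x * (h * g)⁻¹)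
    (hpow : ∀ g ∈ Q, ∀ x ∈ P, g ^ (p - 1) * x * (g ^ (p - 1))⁻¹ = x) :
    PrimeIndexChain Q (Q ⊔ P) := by
  induction hn : Nat.card P using Nat.strong_induction_on generalizing P with
  | _ n ih =>
    by_cases hbot : P = ⊥
    · rw [hbot, sup_bot_eq]
      exact Relation.ReflTransGen.refl
    have : Nontrivial P := P.nontrivial_iff_ne_bot.2 hbot
    obtain ⟨f, hf, hf0, hinv⟩ := hP.exists_invariant_isZModHom (conjHom hQ)
      (fun g h => by
        rw [Commute, SemiconjBy, ← map_mul, ← map_mul]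
        ext x
        exact hcomm g g.2 h h.2 x x.2)
      (fun g => by
        rw [← map_pow]
        ext x
        exact hpow g g.2 x x.2)
    have hidx := hf.index_ker hf0
    set M : Subgroup P := hf.toMonoidHom.ker with hM
    set N : Subgroup G := M.map P.subtype with hN
    have hNP : N ≤ P := Subgroup.map_subtype_le _
    have hNidx : N.relIndex P = p := by
      rw [Subgroup.relIndex, hN, Subgroup.subgroupOf,
        Subgroup.comap_map_eq_self_of_injective P.subtype_injective, hidx]
    have hconj : ∀ g ∈ Q, ∀ x ∈ N, g * x * g⁻¹ ∈ N := by
      rintro g hg _ ⟨x, hx, rfl⟩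
      exact ⟨conjHom hQ ⟨g, hg⟩ x, hinv ⟨g, hg⟩ x hx, rfl⟩
    have hQN : Q ≤ Subgroup.normalizer (N : Set G) := by
      refine fun g hg => Subgroup.mem_normalizer_iff.2 fun x => ⟨hconj g hg x, fun hx => ?_⟩
      have := hconj g⁻¹ (Q.inv_mem hg) _ hx
      simpa [mul_assoc] using this
    have hcard : Nat.card N < n := by
      rw [← hn]
      refine lt_of_le_of_ne (Subgroup.card_le_of_le hNP) fun h => ?_
      have := Subgroup.eq_of_le_of_card_ge hNP h.ge
      rw [this, Subgroup.relIndex_self] at hNidx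
      exact (Fact.out : p.Prime).one_lt.ne hNidx
    exact (ih _ hcard (hP.to_le hNP) hQN
      (fun g hg h hh x hx => hcomm g hg h hh x (hNP hx))
      (fun g hg x hx => hpow g hg x (hNP hx)) rfl).trans
      (primeIndexChain_sup_of_relIndex_eq Fact.out hQ hNP hNidx)

/-- Let the `q`-group `Q = DB` act on the normal `p`-subgroup `P`. If the elements of `D` killed by
all characters to `ZMod p` centralize `P`, and `B` normalizes all subgroups of index `p` of `P`,
then there is a chain with prime indices from `Q` to `QP`. -/
theorem primeIndexChain_sup_of_mul {D B Q P : Subgroup G} [P.Normal] (hP : IsPGroup p P)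
    (hQ : IsPGroup q Q) (hqp : q ≠ p) (hDQ : D ≤ Q) (hBQ : B ≤ Q)
    (hmul : ∀ g ∈ Q, ∃ d ∈ D, ∃ b ∈ B, g = d * b)
    (hD : ∀ k : D, (∀ c : D →* ZMod p, c k = 1) → ∀ x ∈ P, (k : G) * x * (k : G)⁻¹ = x)
    (hB : ∀ M ≤ P, M.relIndex P = p → ∀ b ∈ B, ∀ m ∈ M, b * m * b⁻¹ ∈ M) :
    PrimeIndexChain Q (Q ⊔ P) := by
  have hn : Q ≤ Subgroup.normalizer (P : Set G) := by
    rw [Subgroup.normalizer_eq_top]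
    exact le_top
  set φ := conjHom hn with hφ
  have hcop : ∀ g : Q, (∀ f : P → ZMod p, IsZModHom f → ∀ x, f (φ g x) = f x) → φ g = 1 := by
    intro g hg
    obtain ⟨n, hgn⟩ := hQ g
    exact hP.mulAut_eq_one hqp (n := n) (by rw [← map_pow, hgn, map_one]) hg
  have hscal : ∀ b : Q, (b : G) ∈ B →
      ∃ c : ZMod p, ∀ f : P → ZMod p, IsZModHom f → ∀ x, f (φ b x) = c * f x := by
    intro b hb
    refine exists_scalar_forall fun f hf => hf.exists_scalar fun x hx => ?_
    by_cases hf0 : ∃ x, f x ≠ 0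
    · have hidx := hf.index_ker hf0
      have h1 : (hf.toMonoidHom.ker.map P.subtype).relIndex P = p := by
        rw [Subgroup.relIndex, Subgroup.subgroupOf,
          Subgroup.comap_map_eq_self_of_injective P.subtype_injective, hidx]
      obtain ⟨y, hy, hyx⟩ := hB _ (Subgroup.map_subtype_le _) h1 b hb x ⟨x, hx, rfl⟩
      rwa [← show y = φ b x from Subtype.ext hyx]
    · push Not at hf0
      exact hf0 _
  -- Scalars commute with the whole action on Hom(P, Z/p), so the commutator is trivial there and,
  -- by coprimality, on P.
  have hBcomm : ∀ b : Q, (b : G) ∈ B → ∀ g : Q, Commute (φ b) (φ g) := by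
    intro b hb g
    obtain ⟨c, hc⟩ := hscal b hb
    have h1 : φ (b * g * (g * b)⁻¹) = 1 := by
      refine hcop _ fun f hf x => ?_
      have h2 : ∀ y, f (φ (b * g) y) = f (φ (g * b) y) := by
        intro y
        rw [map_mul, map_mul, MulAut.mul_apply, MulAut.mul_apply, hc f hf]
        exact (hc _ (hf.comp (φ g)) y).symm
      rw [map_mul, MulAut.mul_apply, h2, ← MulAut.mul_apply, ← map_mul, mul_inv_cancel, map_one]
      rfl
    rw [map_mul, map_inv, mul_inv_eq_one, map_mul, map_mul] at h1
    exact h1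
  have hBpow : ∀ b : Q, (b : G) ∈ B → φ b ^ (p - 1) = 1 := by
    intro b hb
    obtain ⟨c, hc⟩ := hscal b hb
    rw [← map_pow]
    refine hcop _ fun f hf x => ?_
    have h2 : ∀ m : ℕ, f (φ (b ^ m) x) = c ^ m * f x := by
      intro m
      induction m with
      | zero => simp
      | succ m ih => rw [pow_succ', map_mul, MulAut.mul_apply, hc f hf, ih]; ring
    rw [h2]
    -- As φ b is invertible, c = 0 forces f to vanish.
    by_cases hc0 : c = 0
    · have h3 : f x = 0 := by
        have := hc f hf ((φ b)⁻¹ x)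
        rwa [MulAut.apply_inv_self, hc0, zero_mul] at this
      rw [h3, mul_zero]
    · rw [ZMod.pow_card_sub_one_eq_one hc0, one_mul]
  have hDcomm : ∀ d e : Q, (d : G) ∈ D → (e : G) ∈ D → Commute (φ d) (φ e) := by
    intro d e hd he
    have h1 : φ (d * e * (e * d)⁻¹) = 1 := by
      ext x
      exact hD (⟨d, hd⟩ * ⟨e, he⟩ * (⟨e, he⟩ * ⟨d, hd⟩)⁻¹)
        (fun c => character_commutator c _ _) x x.2
    rw [map_mul, map_inv, mul_inv_eq_one, map_mul, map_mul] at h1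
    exact h1
  have hDpow : ∀ d : Q, (d : G) ∈ D → φ d ^ (p - 1) = 1 := by
    intro d hd
    rw [← map_pow]
    ext x
    exact hD (⟨d, hd⟩ ^ (p - 1)) (fun c => character_pow c _) x x.2
  have hdec : ∀ g : Q, ∃ d b : Q, (d : G) ∈ D ∧ (b : G) ∈ B ∧ φ g = φ d * φ b := by
    intro g
    obtain ⟨d, hd, b, hb, h⟩ := hmul g g.2
    refine ⟨⟨d, hDQ hd⟩, ⟨b, hBQ hb⟩, hd, hb, ?_⟩
    rw [← map_mul]
    exact congrArg φ (Subtype.ext h)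
  have hcomm : ∀ g h : Q, Commute (φ g) (φ h) := by
    intro g h
    obtain ⟨d, b, hd, hb, hg⟩ := hdec g
    obtain ⟨e, a, he, ha, hh⟩ := hdec h
    have h1 : Commute (φ d) (φ h) := by
      rw [hh]
      exact (hDcomm d e hd he).mul_right (hBcomm a ha d).symm
    rw [hg]
    exact h1.mul_left (hBcomm b hb h)
  have hpow : ∀ g : Q, φ g ^ (p - 1) = 1 := by
    intro g
    obtain ⟨d, b, hd, hb, hg⟩ := hdec g
    rw [hg, (hBcomm b hb d).symm.mul_pow, hDpow d hd, hBpow b hb, one_mul]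
  refine primeIndexChain_sup_of_abelian_action hP hn (fun g hg h hh x hx => ?_)
    (fun g hg x hx => ?_)
  · have h1 := (hcomm ⟨g, hg⟩ ⟨h, hh⟩).eq
    rw [← map_mul, ← map_mul] at h1
    exact congrArg Subtype.val (DFunLike.congr_fun h1 ⟨x, hx⟩)
  · have h1 := hpow ⟨g, hg⟩
    rw [← map_pow] at h1
    exact congrArg Subtype.val (DFunLike.congr_fun h1 ⟨x, hx⟩)

end ConjugationAction

-- The induction on the group order

universe u

/-- Let `A` be normal in `G` with all Sylow subgroups joined to `A` by chains with prime indices,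
and let `B` be a `q`-group normalizing the maximal subgroups of all Sylow subgroups of `A`. Then a
Sylow `q`-subgroup of `AB` containing `B` is joined to `AB` by a chain with prime indices. -/
theorem primeIndexChain_sup_of_normalizes {q : ℕ} [Fact q.Prime] {G : Type u} [Group G] [Finite G]
    (A B Q : Subgroup G) [hA : A.Normal] (hB : IsPGroup q B)
    (hW : ∀ r, r.Prime → ∀ S, IsSylowIn r S A → PrimeIndexChain S A)
    (hN : ∀ r, r.Prime → ∀ S, IsSylowIn r S A → ∀ M ≤ S, M.relIndex S = r →
      ∀ b ∈ B, ∀ m ∈ M, b * m * b⁻¹ ∈ M)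
    (hQ : IsSylowIn q Q (A ⊔ B)) (hBQ : B ≤ Q) : PrimeIndexChain Q (A ⊔ B) := by
  induction hn : Nat.card G using Nat.strong_induction_on generalizing G with
  | _ n ih =>
    by_cases hbot : A = ⊥
    · rw [hbot, bot_sup_eq] at hQ ⊢
      rw [le_antisymm hQ.le hBQ]
      exact Relation.ReflTransGen.refl
    obtain ⟨p, hpA, hmax⟩ := (Nat.card A).primeFactors.exists_max_image id
      (Nat.nonempty_primeFactors.2 (A.one_lt_card_iff_ne_bot.2 hbot))
    have hp : p.Prime := Nat.prime_of_mem_primeFactors hpA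
    have : Fact p.Prime := ⟨hp⟩
    obtain ⟨P, hP, -⟩ := (IsPGroup.of_bot (p := p) (G := G)).exists_isSylowIn (bot_le : ⊥ ≤ A)
    have hPn : P ≠ ⊥ := by
      rintro rfl
      refine hP.not_dvd ?_
      rw [Subgroup.relIndex_bot_left]
      exact Nat.dvd_of_mem_primeFactors hpA
    have hAP : A ≤ Subgroup.normalizer (P : Set G) :=
      hP.le_normalizer_of_primeIndexChain
        (fun r hr hd => hmax r (Nat.mem_primeFactors.2 ⟨hr, hd, Nat.card_pos.ne'⟩)) (hW p hp P hP)
    have hPnormal : P.Normal := by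
      -- Each G-conjugate of P is a p-subgroup of A, so it normalizes P and therefore lies in the
      -- Sylow subgroup P.
      refine ⟨fun x hx g => ?_⟩
      have hle : P.map (MulAut.conj g).toMonoidHom ≤ A := by
        rintro _ ⟨y, hy, rfl⟩
        exact hA.conj_mem y (hP.le hy) g
      exact hP.le_of_isPGroup (hP.isPGroup.map _) hle (hle.trans hAP) ⟨x, hx, rfl⟩
    let π := QuotientGroup.mk' P
    have hcard : Nat.card (G ⧸ P) < n := by
      have h1 := P.card_eq_card_quotient_mul_card_subgroup
      have h2 := P.one_lt_card_iff_ne_bot.2 hPn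
      have h3 : 0 < Nat.card (G ⧸ P) := Nat.card_pos
      nlinarith
    have hAn : (A.map π).Normal := hA.map π (QuotientGroup.mk'_surjective P)
    have hquot : PrimeIndexChain (Q.map π) (A.map π ⊔ B.map π) := by
      refine ih _ hcard (A.map π) (B.map π) (Q.map π) (hB.map π) ?_ ?_ ?_
        (Subgroup.map_mono hBQ) rfl
      · intro r hr S' hS'
        have : Fact r.Prime := ⟨hr⟩
        obtain ⟨S, hS, rfl⟩ := hS'.exists_map_eq
        exact (hW r hr S hS).map π
      · intro r hr S' hS' M' hM' hidx
        have : Fact r.Prime := ⟨hr⟩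
        obtain ⟨S, hS, rfl⟩ := hS'.exists_map_eq
        rintro _ ⟨b, hb, rfl⟩ m' hm'
        obtain ⟨m, hm, rfl⟩ := hM' hm'
        have h1 : (M'.comap π ⊓ S).relIndex S = r := by
          rw [Subgroup.inf_relIndex_right, Subgroup.relIndex_comap, hidx]
        have h2 := (hN r hr S hS _ inf_le_right h1 b hb m ⟨hm', hm⟩).1
        simpa using h2
      · rw [← Subgroup.map_sup]
        exact hQ.map π
    have hlift : PrimeIndexChain (Q ⊔ P) (A ⊔ B) := by
      have h1 := hquot.comap (QuotientGroup.mk'_surjective P)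
      rw [← Subgroup.map_sup, Subgroup.comap_map_eq, Subgroup.comap_map_eq,
        QuotientGroup.ker_mk'] at h1
      rwa [sup_eq_left.2 (hP.le.trans le_sup_left : P ≤ A ⊔ B)] at h1
    refine PrimeIndexChain.trans ?_ hlift
    by_cases hqp : q = p
    · subst hqp
      have hPQ : Q = Q ⊔ P := hQ.eq_of_le (hQ.isPGroup.to_sup_of_normal_right hP.isPGroup)
        (sup_le hQ.le (hP.le.trans le_sup_left)) le_sup_left
      rw [← hPQ]
      exact Relation.ReflTransGen.refl
    · have hD : IsSylowIn q (Q ⊓ A) A := hQ.inf_normal le_sup_left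
      have hDc := hW q Fact.out _ hD
      refine primeIndexChain_sup_of_mul (D := Q ⊓ A) (B := B) hP.isPGroup hQ.isPGroup hqp
        inf_le_left hBQ (fun g hg => ?_) (fun k hk x hx => ?_) (hN p hp P hP)
      · obtain ⟨a, ha, b, hb, rfl⟩ := Subgroup.mem_sup_of_normal_left.1 (hQ.le hg)
        exact ⟨a, ⟨(Q.mul_mem_cancel_right (hBQ hb)).1 hg, ha⟩, b, hb, rfl⟩
      · exact conj_eq_of_primeIndexChain hP.isPGroup hD.isPGroup hqp hDc hk x ⟨hP.le hx, hx⟩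

/-! ### Weak direct products -/

section WeakDirectProduct

variable {G : Type u} [Group G]

theorem IsWSupersoluble.primeIndexChain [Finite G] {A : Subgroup G} (hA : IsWSupersoluble A)
    {p : ℕ} (hp : p.Prime) {S : Subgroup G} (hS : IsSylowIn p S A) : PrimeIndexChain S A := by
  have : Fact p.Prime := ⟨hp⟩
  let P : Sylow p A :=
    (hS.isPGroup.of_equiv (Subgroup.subgroupOfEquivOfLe hS.le).symm).toSylow hS.not_dvd
  have h := (isPSubnormal_iff_primeIndexChain.1 (hA p hp P)).map A.subtype
  have h1 : (P : Subgroup A).map A.subtype = S := Subgroup.map_subgroupOf_eq_of_le hS.le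
  rwa [h1, ← MonoidHom.range_eq_map, A.range_subtype] at h

/-- Permutability gives bm = m'b'. Then b'b⁻¹ = m'⁻¹(bmb⁻¹) lies in A ∩ B = 1, so bmb⁻¹ = m'. -/
theorem IsWeakDirectProduct.conj_mem [Finite G] {A B : Subgroup G} (hG : IsWeakDirectProduct A B)
    {p : ℕ} (hp : p.Prime) {S M : Subgroup G} (hS : IsSylowIn p S A) (hMS : M ≤ S)
    (hM : M.relIndex S = p) {b m : G} (hb : b ∈ B) (hm : m ∈ M) : b * m * b⁻¹ ∈ M := by
  have : Fact p.Prime := ⟨hp⟩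
  let P : Sylow p A :=
    (hS.isPGroup.of_equiv (Subgroup.subgroupOfEquivOfLe hS.le).symm).toSylow hS.not_dvd
  have hPS : (P : Subgroup A).map A.subtype = S := Subgroup.map_subgroupOf_eq_of_le hS.le
  have hcov : M ⋖ S := by
    refine ⟨lt_of_le_of_ne hMS ?_, fun C hMC hCS => ?_⟩
    · rintro rfl
      rw [Subgroup.relIndex_self] at hM
      exact hp.one_lt.ne hM
    · have h1 := Subgroup.relIndex_mul_relIndex M C S hMC.le hCS.le
      rw [hM] at h1
      rcases (Nat.dvd_prime hp).1 (Dvd.intro _ h1) with h2 | h2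
      · exact hMC.not_ge (Subgroup.relIndex_eq_one.1 h2)
      · rw [h2] at h1
        exact hCS.not_ge (Subgroup.relIndex_eq_one.1
          (Nat.eq_of_mul_eq_mul_left hp.pos (h1.trans (mul_one p).symm)))
  have hperm : SubgroupsPermute B M := hG.permutes p hp P M (hPS.symm ▸ hcov)
  have hbm : b * m ∈ (M : Set G) * (B : Set G) := hperm ▸ Set.mul_mem_mul hb hm
  obtain ⟨m', hm', b', hb', h⟩ := hbm
  have hMA := hMS.trans hS.le
  have h : m' * b' = b * m := h
  have h1 : b' * b⁻¹ = m'⁻¹ * (b * m * b⁻¹) := by rw [← h]; group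
  have h2 : b' * b⁻¹ ∈ A ⊓ B := by
    refine ⟨?_, B.mul_mem hb' (B.inv_mem hb)⟩
    rw [h1]
    exact A.mul_mem (A.inv_mem (hMA hm')) (hG.normal.conj_mem m (hMA hm) b)
  rw [hG.inf_eq_bot, Subgroup.mem_bot, h1, inv_mul_eq_one] at h2
  rwa [← h2]

end WeakDirectProduct

theorem corollaryA {G : Type*} [Group G] [Finite G] (A B : Subgroup G)
    (hG : IsWeakDirectProduct A B) (hA : IsWSupersoluble A) (hB : IsWSupersoluble B) :
    IsWSupersoluble G := by
  intro q hq R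
  have : Fact q.Prime := ⟨hq⟩
  have := hG.normal
  obtain ⟨C, hC, -⟩ := (IsPGroup.of_bot (p := q) (G := G)).exists_isSylowIn (bot_le : ⊥ ≤ B)
  obtain ⟨Q, hQ, hCQ⟩ := hC.isPGroup.exists_isSylowIn (le_sup_right : C ≤ A ⊔ C)
  have hQc : PrimeIndexChain Q (A ⊔ C) :=
    primeIndexChain_sup_of_normalizes A C Q hC.isPGroup
      (fun r hr S hS => hA.primeIndexChain hr hS)
      (fun r hr S hS M hM hidx b hb m hm => hG.conj_mem hr hS hM hidx (hC.le hb) hm) hQ hCQ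
  have htop : B ⊔ A = ⊤ := by
    rw [sup_comm]
    refine (Subgroup.eq_top_iff' _).2 fun g => ?_
    obtain ⟨a, ha, b, hb, rfl⟩ := hG.mul_eq_univ ▸ Set.mem_univ g
    exact Subgroup.mul_mem_sup ha hb
  have hCc : PrimeIndexChain (A ⊔ C) ⊤ := by
    have h := (hB.primeIndexChain hq hC).sup_normal A
    rwa [htop, sup_comm] at h
  have hQtop : IsSylowIn q Q ⊤ := by
    -- |G : AC| divides |B : C|, which is prime to q.
    refine hQ.trans le_top fun hd => hC.not_dvd (hd.trans ?_)
    have h := relIndex_map_map_dvd (QuotientGroup.mk' A) C B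
    rwa [Subgroup.relIndex_map_map, QuotientGroup.ker_mk', htop, sup_comm] at h
  let Q' : Sylow q G := hQ.isPGroup.toSylow (by simpa using hQtop.not_dvd)
  obtain ⟨g, hg⟩ := MulAction.exists_smul_eq G Q' R
  have h := (hQc.trans hCc).map (MulAut.conj g).toMonoidHom
  rw [Subgroup.map_top_of_surjective _ (MulAut.conj g).surjective] at h
  rw [isPSubnormal_iff_primeIndexChain, ← hg]
  exact h
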